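/- Let $|0\rangle,|1\rangle$ be the standard basis of $\mathbb{C}^2$, and for $\theta\in\mathbb{R}$ let $|\theta\rangle=\cos\frac{\theta}{2}|0\rangle+\sin\frac{\theta}{2}|1\rangle$. Let $\mathbb{RP}^1=\{|\theta\rangle\langle\theta| : \theta\in\mathbb{R}\}$ be the set of real one-dimensional projectors on $\mathbb{C}^2$. For an operator $\rho_{AB}$ on $\mathbb{C}^2\otimes\mathbb{C}^2$ put $\tilde\rho_B(\theta)=\mathrm{Tr}_A\big[(|\theta\rangle\langle\theta|\otimes\mathbb{I})\rho_{AB}\big]$. A two-qubit state $\rho_{AB}$ with real matrix entries is called RP-unsteerable if there is a local hidden state model for all real projective measurements $\{|\theta\rangle\langle\theta|,|\theta+\pi\rangle\langle\theta+\pi|\}$ of Alice, that is, a Borel probability measure $\mu$ on $\mathbb{RP}^1$ and measurable functions $f_{\theta,0},f_{\theta,1}\colon\mathbb{RP}^1\to[0,1]$ $(\theta\in\mathbb{R})$ with $f_{\theta,0}+f_{\theta,1}=1$ such that $$\tilde\rho_B(\theta+a\pi)=\int_{\mathbb{RP}^1}x\,f_{\theta,a}(x)\,\mathrm{d}\mu(x)\qquad\text{for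 all }\theta\in\mathbb{R},\ a\in\{0,1\};$$ otherwise it is called RP-steerable. Theorem. For $\eta\in[0,1]$ let $\rho_{AB}(\eta)=\eta\,|\Phi_+\rangle\langle\Phi_+|+(1-\eta)\,\mathbb{I}/4$ be the Werner state, where $|\Phi_+\rangle=\frac{1}{\sqrt2}(|00\rangle+|11\rangle)$. Then $\rho_{AB}(\eta)$ is RP-unsteerable if $\eta\le\frac{2}{\pi}$, and RP-steerable if $\eta>\frac{2}{\pi}$. -/

import Mathlib

open MeasureTheory
open scoped Kronecker

noncomputable section

/-- Operators on the qubit space `ℂ²`, in the standard basis `|0⟩, |1⟩`. -/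
abbrev QubitOp : Type := Matrix (Fin 2) (Fin 2) ℂ

/-- Operators on `ℂ² ⊗ ℂ²`, in the standard basis `|ij⟩`; the first index belongs to Alice,
the second to Bob. -/
abbrev TwoQubitOp : Type := Matrix (Fin 2 × Fin 2) (Fin 2 × Fin 2) ℂ

/-- The outer product `|ψ⟩⟨ψ|`. -/
def ketbra {ι : Type*} (ψ : ι → ℂ) : Matrix ι ι ℂ := Matrix.vecMulVec ψ (star ψ)

/-- The tensor product `|u⟩ ⊗ |v⟩`. -/
def tensorKet (u v : Fin 2 → ℂ) : Fin 2 × Fin 2 → ℂ := fun p => u p.1 * v p.2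

/-- The basis vector `|0⟩`. -/
def ket0 : Fin 2 → ℂ := ![1, 0]

/-- The basis vector `|1⟩`. -/
def ket1 : Fin 2 → ℂ := ![0, 1]

/-- The real unit vector `|θ⟩ = cos (θ/2) |0⟩ + sin (θ/2) |1⟩`. -/
def ketAngle (θ : ℝ) : Fin 2 → ℂ :=
  ((Real.cos (θ / 2) : ℝ) : ℂ) • ket0 + ((Real.sin (θ / 2) : ℝ) : ℂ) • ket1

/-- The set `ℝP¹` of real one-dimensional projectors on `ℂ²`, i.e. of all `|θ⟩⟨θ|`. -/
def RP1 : Set QubitOp := Set.range fun θ : ℝ => ketbra (ketAngle θ)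

/-- `ℝP¹` carries the Borel σ-algebra of its topology as a set of `2 × 2` matrices. -/
instance RP1.instMeasurableSpace : MeasurableSpace RP1 := borel RP1

instance RP1.instBorelSpace : BorelSpace RP1 := ⟨rfl⟩

/-- The partial trace over Alice's qubit. -/
def partialTraceA (M : TwoQubitOp) : QubitOp :=
  Matrix.of fun i j => ∑ k : Fin 2, M (k, i) (k, j)

/-- The subnormalized state of Bob `Tr_A [(|θ⟩⟨θ| ⊗ I) ρ]`. -/
def steeringEllipse (ρ : TwoQubitOp) (θ : ℝ) : QubitOp :=
  partialTraceA ((ketbra (ketAngle θ) ⊗ₖ (1 : QubitOp)) * ρ)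

/-- The operator `∫ x f(x) dμ(x)` for a measure `μ` on `ℝP¹` (the integral is taken entrywise). -/
def boxIntegral (μ : Measure RP1) (f : RP1 → ℝ) : QubitOp :=
  Matrix.of fun i j => ∫ x : RP1, (x : QubitOp) i j * ((f x : ℝ) : ℂ) ∂μ

/-- The family `σ q a` of subnormalized states (`q` a measurement of Alice, `a` an outcome) has a
local hidden state model: a probability distribution `μ` on `ℝP¹` and response functions
`f q a : ℝP¹ → [0, 1]` with `∑ a, f q a x = 1` that reproduce all of the `σ q a`. -/
def HasLHSModel {Q A : Type*} [Fintype A] (σ : Q → A → QubitOp) : Prop :=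
  ∃ (μ : Measure RP1) (f : Q → A → RP1 → ℝ),
    IsProbabilityMeasure μ ∧
    (∀ q a, Measurable (f q a)) ∧
    (∀ q a x, f q a x ∈ Set.Icc (0 : ℝ) 1) ∧
    (∀ q x, ∑ a, f q a x = 1) ∧
    (∀ q a, σ q a = boxIntegral μ (f q a))

/-- Bob's subnormalized states when Alice performs the real projective measurement
`{|θ⟩⟨θ|, |θ + π⟩⟨θ + π|}`: outcome `0` belongs to `|θ⟩⟨θ|` and outcome `1` to `|θ + π⟩⟨θ + π|`. -/
def realProjectiveAssemblage (ρ : TwoQubitOp) : ℝ → Fin 2 → QubitOp :=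
  fun θ a => steeringEllipse ρ (θ + (a : ℕ) * Real.pi)

/-- `ρ` is RP-unsteerable: one local hidden state model covers all real projective measurements. -/
def RPUnsteerable (ρ : TwoQubitOp) : Prop := HasLHSModel (realProjectiveAssemblage ρ)

/-- `ρ` is RP-steerable: there is no such model. -/
def RPSteerable (ρ : TwoQubitOp) : Prop := ¬ RPUnsteerable ρ

/-- The maximally entangled vector `|Φ₊⟩ = (|00⟩ + |11⟩) / √2`. -/
def phiPlus : Fin 2 × Fin 2 → ℂ :=
  ((1 / Real.sqrt 2 : ℝ) : ℂ) • (tensorKet ket0 ket0 + tensorKet ket1 ket1)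

/-- The Werner state `η |Φ₊⟩⟨Φ₊| + (1 - η) I / 4`. -/
def wernerState (η : ℝ) : TwoQubitOp :=
  (η : ℂ) • ketbra phiPlus + (((1 - η) / 4 : ℝ) : ℂ) • (1 : TwoQubitOp)

end

/-!
In Bloch coordinates `ℝP¹` is the unit circle, `|φ⟩⟨φ|` being the point `(cos φ, sin φ)`, and
Alice's measurement `θ` on the Werner state steers Bob to the unnormalized Bloch vectors
`± (η / 2) (cos θ, sin θ)`.

In any local hidden state model the component along `θ` of the difference of the two steered states
is at most the `μ`-mean of `|cos (φ - θ)|`, because the responses differ by at most `1`. Averaging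
over `θ` and exchanging the integrals replaces this mean by the average `2 / π` of `|cos|` over the
circle, whatever `μ` is; hence `|η| ≤ 2 / π`. Conversely, the uniform distribution on the circle
with the response `(1 + s * sign (cos (φ - θ))) / 2`, where `|s| ≤ 1`, attains `η = 2 * s / π`.
-/

noncomputable section

open Real Set

/-! ### Integrals over the circle -/

theorem measurable_sign : Measurable Real.sign :=
  Measurable.ite measurableSet_Iio measurable_const
    (Measurable.ite measurableSet_Ioi measurable_const measurable_const)

theorem abs_sign_le_one (r : ℝ) : |Real.sign r| ≤ 1 := by
  rcases Real.sign_apply_eq r with h | h | h <;> simp [h]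

theorem mul_sign_eq_abs (r : ℝ) : r * Real.sign r = |r| := by
  rcases lt_trichotomy r 0 with h | h | h
  · rw [Real.sign_of_neg h, abs_of_neg h, mul_neg_one]
  · simp [h]
  · rw [Real.sign_of_pos h, abs_of_pos h, mul_one]

theorem intervalIntegrable_mul_sign_cos_sub {g : ℝ → ℝ} {a b : ℝ}
    (hg : IntervalIntegrable g volume a b) (θ : ℝ) :
    IntervalIntegrable (fun φ ↦ g φ * Real.sign (cos (φ - θ))) volume a b :=
  intervalIntegrable_iff.2 <| (intervalIntegrable_iff.1 hg).mul_bdd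
    (measurable_sign.comp (by fun_prop)).aestronglyMeasurable
    (.of_forall fun _ ↦ abs_sign_le_one _)

theorem integral_mul_sign_cos_sub {g : ℝ → ℝ} (hg : Function.Periodic g (2 * π))
    (hgi : IntervalIntegrable g volume 0 (2 * π)) (θ : ℝ) :
    ∫ φ in 0..2 * π, g φ * Real.sign (cos (φ - θ)) =
      ∫ φ in (θ - π / 2)..(θ + π / 2), (g φ - g (φ + π)) := by
  set F : ℝ → ℝ := fun φ ↦ g φ * Real.sign (cos (φ - θ)) with hF
  have hF_int : ∀ a b, IntervalIntegrable F volume a b := fun a b ↦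
    intervalIntegrable_mul_sign_cos_sub (hg.intervalIntegrable₀ two_pi_pos.ne' hgi a b) θ
  have hF_per : Function.Periodic F (2 * π) := fun φ ↦ by
    simp only [hF, hg φ, add_sub_right_comm φ, cos_add_two_pi]
  have hshift : ∫ φ in (θ + π / 2)..(θ - π / 2 + 2 * π), F φ =
      ∫ φ in (θ - π / 2)..(θ + π / 2), F (φ + π) := by
    rw [intervalIntegral.integral_comp_add_right]
    congr 1 <;> ring
  have hF_comp : IntervalIntegrable (fun φ ↦ F (φ + π)) volume (θ - π / 2) (θ + π / 2) := by
    simpa using (hF_int (θ - π / 2 + π) (θ + π / 2 + π)).comp_add_right π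
  calc ∫ φ in 0..2 * π, F φ = ∫ φ in (θ - π / 2)..(θ - π / 2 + 2 * π), F φ := by
        simpa using hF_per.intervalIntegral_add_eq 0 (θ - π / 2)
    _ = ∫ φ in (θ - π / 2)..(θ + π / 2), (F φ + F (φ + π)) := by
        rw [← intervalIntegral.integral_add_adjacent_intervals (hF_int _ (θ + π / 2)) (hF_int _ _),
          hshift, intervalIntegral.integral_add (hF_int _ _) hF_comp]
    _ = ∫ φ in (θ - π / 2)..(θ + π / 2), (g φ - g (φ + π)) := by
        refine intervalIntegral.integral_congr_Ioo_of_le (by linarith [pi_pos]) fun φ hφ ↦ ?_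
        have hcos : 0 < cos (φ - θ) :=
          cos_pos_of_mem_Ioo ⟨by linarith [hφ.1], by linarith [hφ.2]⟩
        simp only [hF, add_sub_right_comm φ, cos_add_pi, Real.sign_neg, Real.sign_of_pos hcos]
        ring

theorem integral_sign_cos_sub (θ : ℝ) : ∫ φ in 0..2 * π, Real.sign (cos (φ - θ)) = 0 := by
  simpa using integral_mul_sign_cos_sub (g := fun _ ↦ 1) (fun _ ↦ rfl) intervalIntegrable_const θ

theorem integral_cos_mul_sign_cos_sub (θ : ℝ) :
    ∫ φ in 0..2 * π, cos φ * Real.sign (cos (φ - θ)) = 4 * cos θ := by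
  rw [integral_mul_sign_cos_sub cos_periodic (continuous_cos.intervalIntegrable _ _)]
  simp only [cos_add_pi, sub_neg_eq_add, ← two_mul, intervalIntegral.integral_const_mul,
    integral_cos, sin_add_pi_div_two, sin_sub_pi_div_two]
  ring

theorem integral_sin_mul_sign_cos_sub (θ : ℝ) :
    ∫ φ in 0..2 * π, sin φ * Real.sign (cos (φ - θ)) = 4 * sin θ := by
  rw [integral_mul_sign_cos_sub sin_periodic (continuous_sin.intervalIntegrable _ _)]
  simp only [sin_add_pi, sub_neg_eq_add, ← two_mul, intervalIntegral.integral_const_mul,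
    integral_sin, cos_add_pi_div_two, cos_sub_pi_div_two]
  ring

theorem integral_abs_cos_sub (θ : ℝ) : ∫ φ in 0..2 * π, |cos (φ - θ)| = 4 := by
  calc ∫ φ in 0..2 * π, |cos (φ - θ)|
      = ∫ φ in 0..2 * π, (cos θ * (cos φ * Real.sign (cos (φ - θ))) +
          sin θ * (sin φ * Real.sign (cos (φ - θ)))) := by
        refine intervalIntegral.integral_congr fun φ _ ↦ ?_
        rw [← mul_sign_eq_abs]
        nth_rw 1 [cos_sub]
        ring
    _ = cos θ * (4 * cos θ) + sin θ * (4 * sin θ) := by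
        rw [intervalIntegral.integral_add, intervalIntegral.integral_const_mul,
          intervalIntegral.integral_const_mul, integral_cos_mul_sign_cos_sub,
          integral_sin_mul_sign_cos_sub]
        · exact (intervalIntegrable_mul_sign_cos_sub
            (continuous_cos.intervalIntegrable _ _) θ).const_mul _
        · exact (intervalIntegrable_mul_sign_cos_sub
            (continuous_sin.intervalIntegrable _ _) θ).const_mul _
    _ = 4 := by linear_combination 4 * sin_sq_add_cos_sq θ

/-! ### Bloch coordinates -/

/-- The operator `(t I + z Z + x X) / 2` on a qubit, `Z` and `X` being the Pauli matrices: the real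
symmetric operator of trace `t` and Bloch vector `(z, x)`. -/
def blochMatrix (t z x : ℝ) : QubitOp :=
  !![((t + z) / 2 : ℝ), (x / 2 : ℝ); (x / 2 : ℝ), ((t - z) / 2 : ℝ)]

/-- The Bloch coordinate `Tr (Z M)` of a real symmetric operator `M`. -/
def blochZ (M : QubitOp) : ℝ := (M 0 0).re - (M 1 1).re

/-- The Bloch coordinate `Tr (X M)` of a real symmetric operator `M`. -/
def blochX (M : QubitOp) : ℝ := 2 * (M 0 1).re

/-- The component of the Bloch vector of `M` in the direction `(cos θ, sin θ)`, which is the Bloch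
vector of `|θ⟩⟨θ|`. -/
def blochComponent (θ : ℝ) (M : QubitOp) : ℝ := cos θ * blochZ M + sin θ * blochX M

@[simp]
theorem blochZ_blochMatrix (t z x : ℝ) : blochZ (blochMatrix t z x) = z := by
  simp only [blochZ, blochMatrix, Matrix.of_apply, Matrix.cons_val', Matrix.cons_val_zero,
    Matrix.cons_val_one, Matrix.cons_val_fin_one, Complex.ofReal_re]
  ring

@[simp]
theorem blochX_blochMatrix (t z x : ℝ) : blochX (blochMatrix t z x) = x := by
  simp only [blochX, blochMatrix, Matrix.of_apply, Matrix.cons_val', Matrix.cons_val_zero,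
    Matrix.cons_val_one, Matrix.cons_val_fin_one, Complex.ofReal_re]
  ring

theorem blochComponent_blochMatrix (θ t z x : ℝ) :
    blochComponent θ (blochMatrix t z x) = cos θ * z + sin θ * x := by
  simp only [blochComponent, blochZ_blochMatrix, blochX_blochMatrix]

theorem ketbra_ketAngle (θ : ℝ) : ketbra (ketAngle θ) = blochMatrix 1 (cos θ) (sin θ) := by
  have hcos : (1 + cos θ) / 2 = cos (θ / 2) * cos (θ / 2) := by
    rw [← sq, cos_sq, mul_div_cancel₀ θ two_ne_zero]
    ring
  have hcos' : (1 - cos θ) / 2 = sin (θ / 2) * sin (θ / 2) := by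
    linear_combination -hcos - sin_sq_add_cos_sq (θ / 2)
  have hsin : sin θ / 2 = cos (θ / 2) * sin (θ / 2) := by
    rw [← mul_div_cancel₀ θ two_ne_zero, sin_two_mul, mul_div_cancel₀ θ two_ne_zero]
    ring
  rw [blochMatrix, hcos, hcos', hsin]
  ext i j
  fin_cases i <;> fin_cases j <;>
    simp [ketbra, ketAngle, ket0, ket1, Matrix.vecMulVec_apply, mul_comm, -Complex.ofReal_cos,
      -Complex.ofReal_sin]

theorem steeringEllipse_wernerState (η θ : ℝ) :
    steeringEllipse (wernerState η) θ =
      blochMatrix (1 / 2) (η / 2 * cos θ) (η / 2 * sin θ) := by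
  have hsqrt : ((√2 : ℝ) : ℂ)⁻¹ * ((√2 : ℝ) : ℂ)⁻¹ = 1 / 2 := by
    rw [← Complex.ofReal_inv, ← Complex.ofReal_mul, ← mul_inv, mul_self_sqrt (by norm_num)]
    norm_num
  rw [steeringEllipse, ketbra_ketAngle]
  ext i j
  fin_cases i <;> fin_cases j <;>
    simp [blochMatrix, partialTraceA, Matrix.mul_apply, Fintype.sum_prod_type, wernerState, ketbra,
      phiPlus, tensorKet, ket0, ket1, Matrix.vecMulVec_apply, Matrix.one_apply, hsqrt] <;> ring

theorem blochComponent_steeringEllipse_wernerState (η θ φ : ℝ) :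
    blochComponent θ (steeringEllipse (wernerState η) φ) = η / 2 * cos (φ - θ) := by
  rw [steeringEllipse_wernerState, blochComponent_blochMatrix, cos_sub]
  ring

/-! ### The space of real projectors -/

/-- The projector `|φ⟩⟨φ|` as a point of `ℝP¹`. -/
def angleProj (φ : ℝ) : RP1 := ⟨ketbra (ketAngle φ), φ, rfl⟩

theorem surjective_angleProj : Function.Surjective angleProj := by
  rintro ⟨_, φ, rfl⟩
  exact ⟨φ, rfl⟩

theorem coe_angleProj (φ : ℝ) : (angleProj φ : QubitOp) = blochMatrix 1 (cos φ) (sin φ) :=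
  ketbra_ketAngle φ

theorem blochZ_angleProj (φ : ℝ) : blochZ (angleProj φ) = cos φ := by
  rw [coe_angleProj, blochZ_blochMatrix]

theorem blochX_angleProj (φ : ℝ) : blochX (angleProj φ) = sin φ := by
  rw [coe_angleProj, blochX_blochMatrix]

theorem blochComponent_angleProj (θ φ : ℝ) :
    blochComponent θ (angleProj φ) = cos (φ - θ) := by
  rw [coe_angleProj, blochComponent_blochMatrix, cos_sub]
  ring

theorem blochMatrix_blochZ_blochX (x : RP1) : blochMatrix 1 (blochZ x) (blochX x) = x := by
  obtain ⟨φ, rfl⟩ := surjective_angleProj x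
  rw [blochZ_angleProj, blochX_angleProj, coe_angleProj]

theorem abs_blochComponent_le_one (θ : ℝ) (x : RP1) : |blochComponent θ x| ≤ 1 := by
  obtain ⟨φ, rfl⟩ := surjective_angleProj x
  rw [blochComponent_angleProj]
  exact abs_cos_le_one _

@[fun_prop]
theorem continuous_blochZ : Continuous blochZ := by unfold blochZ; fun_prop

@[fun_prop]
theorem continuous_blochX : Continuous blochX := by unfold blochX; fun_prop

@[fun_prop]
theorem continuous_blochComponent (θ : ℝ) : Continuous (blochComponent θ) := by
  unfold blochComponent; fun_prop

theorem continuous_ketbra_ketAngle : Continuous fun φ ↦ ketbra (ketAngle φ) := by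
  have hket : Continuous ketAngle := by unfold ketAngle; fun_prop
  exact hket.matrix_vecMulVec hket.star

theorem continuous_angleProj : Continuous angleProj :=
  continuous_ketbra_ketAngle.subtype_mk _

instance compactSpace_RP1 : CompactSpace RP1 := by
  have hper : Function.Periodic (fun φ ↦ ketbra (ketAngle φ)) (2 * π) := fun φ ↦ by
    simp only [ketbra_ketAngle, cos_add_two_pi, sin_add_two_pi]
  exact isCompact_iff_compactSpace.1 <|
    hper.compact_of_continuous two_pi_pos.ne' continuous_ketbra_ketAngle

/-! ### Operator integrals in Bloch coordinates -/

theorem integrable_mul_of_continuous_of_mem_Icc {X : Type*} [TopologicalSpace X] [CompactSpace X]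
    [MeasurableSpace X] [OpensMeasurableSpace X] {μ : Measure X} [IsFiniteMeasure μ] {u f : X → ℝ}
    (hu : Continuous u) (hf : Measurable f) (hf01 : ∀ x, f x ∈ Icc (0 : ℝ) 1) :
    Integrable (fun x ↦ u x * f x) μ := by
  refine (hu.integrable_of_hasCompactSupport (.of_compactSpace u)).mul_bdd (c := 1)
    hf.aestronglyMeasurable (.of_forall fun x ↦ ?_)
  rw [norm_of_nonneg (hf01 x).1]
  exact (hf01 x).2

section BoxIntegral

variable {μ : Measure RP1} [IsFiniteMeasure μ] {f g : RP1 → ℝ}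

theorem boxIntegral_eq_blochMatrix (hf : Measurable f) (hf01 : ∀ x, f x ∈ Icc (0 : ℝ) 1) :
    boxIntegral μ f =
      blochMatrix (∫ x, f x ∂μ) (∫ x, blochZ x * f x ∂μ) (∫ x, blochX x * f x ∂μ) := by
  have hf_int : Integrable f μ := by
    simpa using integrable_mul_of_continuous_of_mem_Icc continuous_const (u := 1) hf hf01
  have hz_int : Integrable (fun x : RP1 ↦ blochZ x * f x) μ :=
    integrable_mul_of_continuous_of_mem_Icc (by fun_prop) hf hf01
  have hdiag_add : ∫ x : RP1, (1 + blochZ x) / 2 * f x ∂μ =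
      ((∫ x, f x ∂μ) + ∫ x, blochZ x * f x ∂μ) / 2 := by
    rw [← integral_add hf_int hz_int, ← integral_div]
    congr with x
    ring
  have hdiag_sub : ∫ x : RP1, (1 - blochZ x) / 2 * f x ∂μ =
      ((∫ x, f x ∂μ) - ∫ x, blochZ x * f x ∂μ) / 2 := by
    rw [← integral_sub hf_int hz_int, ← integral_div]
    congr with x
    ring
  have hoff : ∫ x : RP1, blochX x / 2 * f x ∂μ = (∫ x, blochX x * f x ∂μ) / 2 := by
    simp only [div_mul_eq_mul_div, integral_div]
  have hentry : ∀ i j, boxIntegral μ f i j =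
      ∫ x : RP1, blochMatrix 1 (blochZ x) (blochX x) i j * (f x : ℂ) ∂μ := fun i j ↦ by
    simp only [blochMatrix_blochZ_blochX, boxIntegral, Matrix.of_apply]
  ext i j
  rw [hentry]
  fin_cases i <;> fin_cases j <;>
    simp only [blochMatrix, Matrix.of_apply, Matrix.cons_val', Matrix.cons_val_zero,
      Matrix.cons_val_one, Matrix.cons_val_fin_one, Fin.zero_eta, Fin.mk_one, ← Complex.ofReal_mul,
      integral_complex_ofReal, hdiag_add, hdiag_sub, hoff]

theorem blochComponent_boxIntegral (θ : ℝ) (hf : Measurable f)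
    (hf01 : ∀ x, f x ∈ Icc (0 : ℝ) 1) :
    blochComponent θ (boxIntegral μ f) = ∫ x, blochComponent θ x * f x ∂μ := by
  have hz_int : Integrable (fun x : RP1 ↦ blochZ x * f x) μ :=
    integrable_mul_of_continuous_of_mem_Icc (by fun_prop) hf hf01
  have hx_int : Integrable (fun x : RP1 ↦ blochX x * f x) μ :=
    integrable_mul_of_continuous_of_mem_Icc (by fun_prop) hf hf01
  rw [boxIntegral_eq_blochMatrix hf hf01, blochComponent_blochMatrix, ← integral_const_mul,
    ← integral_const_mul, ← integral_add (hz_int.const_mul _) (hx_int.const_mul _)]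
  simp only [blochComponent, add_mul, mul_assoc]

/-! ### The steering inequality -/

theorem abs_blochComponent_boxIntegral_sub_le (θ : ℝ) (hf : Measurable f) (hg : Measurable g)
    (hf01 : ∀ x, f x ∈ Icc (0 : ℝ) 1) (hg01 : ∀ x, g x ∈ Icc (0 : ℝ) 1) :
    |blochComponent θ (boxIntegral μ f) - blochComponent θ (boxIntegral μ g)| ≤
      ∫ x, |blochComponent θ x| ∂μ := by
  have hd : Continuous fun x : RP1 ↦ blochComponent θ x := by fun_prop
  have habs_int : Integrable (fun x : RP1 ↦ |blochComponent θ x|) μ :=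
    hd.abs.integrable_of_hasCompactSupport (.of_compactSpace _)
  have hdiff : ∀ x, |f x - g x| ≤ 1 := fun x ↦ by
    rw [abs_le]
    constructor <;> linarith [(hf01 x).1, (hf01 x).2, (hg01 x).1, (hg01 x).2]
  rw [blochComponent_boxIntegral θ hf hf01, blochComponent_boxIntegral θ hg hg01,
    ← integral_sub (integrable_mul_of_continuous_of_mem_Icc hd hf hf01)
      (integrable_mul_of_continuous_of_mem_Icc hd hg hg01)]
  rw [← norm_eq_abs]
  refine norm_integral_le_of_norm_le habs_int (.of_forall fun x ↦ ?_)
  rw [norm_eq_abs, ← mul_sub, abs_mul]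
  exact mul_le_of_le_one_right (abs_nonneg _) (hdiff x)

end BoxIntegral

theorem integral_integral_abs_blochComponent (μ : Measure RP1) [IsFiniteMeasure μ] :
    ∫ θ in 0..2 * π, ∫ x, |blochComponent θ x| ∂μ = μ.real univ * 4 := by
  have hmeas : Measurable fun p : ℝ × RP1 ↦ |blochComponent p.1 p.2| := by
    unfold blochComponent
    fun_prop
  have hint : Integrable (fun p : ℝ × RP1 ↦ |blochComponent p.1 p.2|)
      ((volume.restrict (Ioc 0 (2 * π))).prod μ) :=
    .of_bound hmeas.aestronglyMeasurable 1 <| .of_forall fun p ↦ by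
      simpa using abs_blochComponent_le_one p.1 p.2
  have hinner : ∀ x : RP1, ∫ θ in Ioc 0 (2 * π), |blochComponent θ x| = 4 := fun x ↦ by
    obtain ⟨φ, rfl⟩ := surjective_angleProj x
    simp_rw [blochComponent_angleProj, ← cos_neg (φ - _), neg_sub]
    rw [← intervalIntegral.integral_of_le two_pi_pos.le, integral_abs_cos_sub]
  rw [intervalIntegral.integral_of_le two_pi_pos.le, integral_integral_swap hint]
  simp only [hinner, integral_const, smul_eq_mul]

theorem HasLHSModel.le_two_div_pi {σ : ℝ → Fin 2 → QubitOp} (hσ : HasLHSModel σ) {c : ℝ}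
    (hc : ∀ θ, c ≤ |blochComponent θ (σ θ 0) - blochComponent θ (σ θ 1)|) : c ≤ 2 / π := by
  obtain ⟨μ, f, _, hf, hf01, -, hbox⟩ := hσ
  have hmean : ∀ θ, c ≤ ∫ x, |blochComponent θ x| ∂μ := fun θ ↦ by
    refine (hc θ).trans ?_
    rw [hbox θ 0, hbox θ 1]
    exact abs_blochComponent_boxIntegral_sub_le θ (hf θ 0) (hf θ 1) (hf01 θ 0) (hf01 θ 1)
  have htotal : ∫ θ in 0..2 * π, ∫ x, |blochComponent θ x| ∂μ = 4 := by
    simpa using integral_integral_abs_blochComponent μ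
  have hint : IntervalIntegrable (fun θ ↦ ∫ x, |blochComponent θ x| ∂μ) volume 0 (2 * π) :=
    intervalIntegral.intervalIntegrable_of_integral_ne_zero (by rw [htotal]; norm_num)
  have hconst : 2 * π * c ≤ 4 := by
    simpa [htotal] using intervalIntegral.integral_mono_on two_pi_pos.le
      intervalIntegrable_const hint fun θ _ ↦ hmean θ
  rw [le_div_iff₀ pi_pos]
  linarith

/-! ### The uniform hidden state model -/

/-- The rotation invariant probability measure on `ℝP¹`, as the law of `|φ⟩⟨φ|` for an angle `φ`
uniform on `(0, 2π]`. -/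
def uniformRP1 : Measure RP1 :=
  (ProbabilityTheory.cond volume (Ioc 0 (2 * π))).map angleProj

instance isProbabilityMeasure_uniformRP1 : IsProbabilityMeasure uniformRP1 := by
  have : IsProbabilityMeasure (ProbabilityTheory.cond (volume : Measure ℝ) (Ioc 0 (2 * π))) :=
    ProbabilityTheory.cond_isProbabilityMeasure_of_finite (by simp [pi_pos])
      measure_Ioc_lt_top.ne
  exact Measure.isProbabilityMeasure_map continuous_angleProj.measurable.aemeasurable

theorem integral_uniformRP1 {E : Type*} [NormedAddCommGroup E] [NormedSpace ℝ E] {F : RP1 → E}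
    (hF : AEStronglyMeasurable F uniformRP1) :
    ∫ x, F x ∂uniformRP1 = (2 * π)⁻¹ • ∫ φ in 0..2 * π, F (angleProj φ) := by
  rw [uniformRP1, integral_map continuous_angleProj.measurable.aemeasurable hF,
    ProbabilityTheory.cond, integral_smul_measure, intervalIntegral.integral_of_le two_pi_pos.le]
  simp [pi_pos.le]

/-- The probability with which the hidden state `x = |φ⟩⟨φ|` announces the outcome `|θ⟩⟨θ|`: for
`0 ≤ s ≤ 1`, the sign of `cos (φ - θ)` decides with probability `s`, and a fair coin otherwise. -/
def signResponse (s θ : ℝ) (x : RP1) : ℝ := (1 + s * Real.sign (blochComponent θ x)) / 2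

theorem measurable_signResponse (s θ : ℝ) : Measurable (signResponse s θ) := by
  have hsign : Measurable fun x : RP1 ↦ Real.sign (blochComponent θ x) :=
    measurable_sign.comp ((continuous_blochComponent θ).comp continuous_subtype_val).measurable
  unfold signResponse
  fun_prop

theorem signResponse_mem_Icc {s : ℝ} (hs : |s| ≤ 1) (θ : ℝ) (x : RP1) :
    signResponse s θ x ∈ Icc (0 : ℝ) 1 := by
  have hbound : |s * Real.sign (blochComponent θ x)| ≤ 1 := by
    rw [abs_mul]
    exact mul_le_one₀ hs (abs_nonneg _) (abs_sign_le_one _)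
  obtain ⟨hlower, hupper⟩ := abs_le.1 hbound
  constructor <;> unfold signResponse <;> linarith

theorem signResponse_add_signResponse_add_pi (s θ : ℝ) (x : RP1) :
    signResponse s θ x + signResponse s (θ + π) x = 1 := by
  have hneg : blochComponent (θ + π) x = -blochComponent θ x := by
    simp only [blochComponent, cos_add_pi, sin_add_pi]
    ring
  rw [signResponse, signResponse, hneg, Real.sign_neg]
  ring

theorem integral_mul_signResponse_uniformRP1 {u : RP1 → ℝ} (hu : Continuous u) (s θ : ℝ) :
    ∫ x, u x * signResponse s θ x ∂uniformRP1 =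
      ((∫ φ in 0..2 * π, u (angleProj φ)) +
        s * ∫ φ in 0..2 * π, u (angleProj φ) * Real.sign (cos (φ - θ))) / (4 * π) := by
  have hu_int : IntervalIntegrable (fun φ ↦ u (angleProj φ)) volume 0 (2 * π) :=
    (hu.comp continuous_angleProj).intervalIntegrable _ _
  have hexpand : ∀ φ, u (angleProj φ) * signResponse s θ (angleProj φ) =
      (u (angleProj φ) + s * (u (angleProj φ) * Real.sign (cos (φ - θ)))) / 2 := fun φ ↦ by
    rw [signResponse, blochComponent_angleProj]
    ring
  have hmeas : Measurable fun x ↦ u x * signResponse s θ x :=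
    hu.measurable.mul (measurable_signResponse s θ)
  rw [integral_uniformRP1 hmeas.aestronglyMeasurable]
  simp_rw [hexpand]
  rw [intervalIntegral.integral_div, intervalIntegral.integral_add hu_int
    ((intervalIntegrable_mul_sign_cos_sub hu_int θ).const_mul s),
    intervalIntegral.integral_const_mul, smul_eq_mul]
  ring

theorem boxIntegral_uniformRP1_signResponse {s : ℝ} (hs : |s| ≤ 1) (θ : ℝ) :
    boxIntegral uniformRP1 (signResponse s θ) =
      blochMatrix (1 / 2) (s / π * cos θ) (s / π * sin θ) := by
  have htrace : ∫ x, signResponse s θ x ∂uniformRP1 = 1 / 2 := by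
    have h := integral_mul_signResponse_uniformRP1 (u := fun _ ↦ 1) continuous_const s θ
    simp only [one_mul, integral_sign_cos_sub, intervalIntegral.integral_const, smul_eq_mul] at h
    rw [h]
    field_simp
    ring
  have hz : ∫ x : RP1, blochZ x * signResponse s θ x ∂uniformRP1 = s / π * cos θ := by
    rw [integral_mul_signResponse_uniformRP1 (u := fun x ↦ blochZ x) (by fun_prop)]
    simp only [blochZ_angleProj, integral_cos_mul_sign_cos_sub, integral_cos, sin_two_pi, sin_zero]
    field_simp
    ring
  have hx : ∫ x : RP1, blochX x * signResponse s θ x ∂uniformRP1 = s / π * sin θ := by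
    rw [integral_mul_signResponse_uniformRP1 (u := fun x ↦ blochX x) (by fun_prop)]
    simp only [blochX_angleProj, integral_sin_mul_sign_cos_sub, integral_sin, cos_two_pi, cos_zero]
    field_simp
    ring
  rw [boxIntegral_eq_blochMatrix (measurable_signResponse s θ) (signResponse_mem_Icc hs θ),
    htrace, hz, hx]

/-! ### Werner states -/

theorem rpUnsteerable_wernerState {η : ℝ} (hη : |η| ≤ 2 / π) : RPUnsteerable (wernerState η) := by
  have hs : |η * π / 2| ≤ 1 := by
    rw [le_div_iff₀ pi_pos] at hη
    rw [abs_div, abs_mul, abs_of_pos pi_pos, abs_two]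
    linarith
  refine ⟨uniformRP1, fun θ a ↦ signResponse (η * π / 2) (θ + (a : ℕ) * π), inferInstance,
    fun _ _ ↦ measurable_signResponse _ _, fun _ _ ↦ signResponse_mem_Icc hs _,
    fun θ x ↦ ?_, fun θ a ↦ ?_⟩
  · simpa using signResponse_add_signResponse_add_pi (η * π / 2) θ x
  · have hscale : η * π / 2 / π = η / 2 := by field_simp
    rw [boxIntegral_uniformRP1_signResponse hs, hscale, realProjectiveAssemblage,
      steeringEllipse_wernerState]

theorem abs_le_two_div_pi_of_rpUnsteerable {η : ℝ} (h : RPUnsteerable (wernerState η)) :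
    |η| ≤ 2 / π := by
  refine HasLHSModel.le_two_div_pi h fun θ ↦ le_of_eq ?_
  simp only [realProjectiveAssemblage, blochComponent_steeringEllipse_wernerState]
  simp

theorem theorem3_general (η : ℝ) : RPUnsteerable (wernerState η) ↔ |η| ≤ 2 / π :=
  ⟨abs_le_two_div_pi_of_rpUnsteerable, rpUnsteerable_wernerState⟩

end

theorem theorem3 (η : ℝ) (hη : η ∈ Set.Icc (0 : ℝ) 1) :
    (η ≤ 2 / Real.pi → RPUnsteerable (wernerState η)) ∧
      (2 / Real.pi < η → RPSteerable (wernerState η)) := by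
  rw [RPSteerable, theorem3_general, abs_of_nonneg hη.1, not_le]
  exact ⟨id, id⟩
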